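/- A category is called semi-abelian if it is pointed, has binary coproducts, is Barr exact (finitely complete, with pullback-stable coequalizers of kernel pairs, and such that every internal equivalence relation is a kernel pair) and Bourn protomodular (equivalently, the split short five lemma holds). A torsion theory in a semi-abelian category $\mathbb{X}$ is a pair $(\mathcal{T},\mathcal{F})$ of full replete subcategories such that every morphism from an object of $\mathcal{T}$ to an object of $\mathcal{F}$ is zero, and for every object $X$ there is a short exact sequence $0\to T_X\to X\to F_X\to 0$ with $T_X\in\mathcal{T}$ and $F_X\in\mathcal{F}$ (that is, $T_X\to X$ is a kernel of $X\to F_X$ and $X\to F_X$ is a cokernel of $T_X\to X$). It is hereditary if $\mathcal{T}$ is closed under subobjects in $\mathbb{X}$, and cohereditary if $\mathcal{F}$ is closed under quotients in $\mathbb{X}$, i.e. for every normal epimorphism $q:A\to Q$ with $A\in\mathcal{F}$ also $Q\in\mathcal{F}$. One writes $(\mathcal{S},\mathcal{G})\le(\mathcal{T},\mathcal{F})$ if $\mathcal{S}\subseteq\mathcal{T}$. **Corollary.** Let $\mathbb{X}$ be a semi-abelian category, and let $(\mathcal{T},\mathcal{F})$ and $(\mathcal{S},\mathcal{G})$ be torsion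 theories in $\mathbb{X}$ with $(\mathcal{S},\mathcal{G})\le(\mathcal{T},\mathcal{F})$. If $(\mathcal{T},\mathcal{F})$ is hereditary and $(\mathcal{S},\mathcal{G})$ is cohereditary, then the full subcategory $\mathcal{Z}=\mathcal{T}\cap\mathcal{G}$ of $\mathbb{X}$ (the category of trivial objects of the pair $(\mathcal{T},\mathcal{G})$) is semi-abelian. -/

import Mathlib

open CategoryTheory CategoryTheory.Limits

universe v u

/-- A (Barr-)exact category: a regular category in which every internal equivalence relation is
the kernel pair of some arrow. -/
class IsBarrExact (C : Type u) [Category.{v} C] : Prop extends Regular C where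
  exists_isKernelPair : ∀ {R X : C} (p₁ p₂ : R ⟶ X), IsEquivalenceRelation p₁ p₂ →
    ∃ (Y : C) (f : X ⟶ Y), IsKernelPair f p₁ p₂

/-- `k` is a kernel of `f`. -/
def IsKernelOf {C : Type u} [Category.{v} C] [HasZeroMorphisms C] {K X Y : C}
    (k : K ⟶ X) (f : X ⟶ Y) : Prop :=
  ∃ w : k ≫ f = 0, Nonempty (IsLimit (KernelFork.ofι k w))

/-- `q` is a cokernel of `f`. -/
def IsCokernelOf {C : Type u} [Category.{v} C] [HasZeroMorphisms C] {X Y Q : C}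
    (q : Y ⟶ Q) (f : X ⟶ Y) : Prop :=
  ∃ w : f ≫ q = 0, Nonempty (IsColimit (CokernelCofork.ofπ q w))

/-- The split short five lemma, i.e. Bourn protomodularity of a pointed category with finite
limits. -/
class SplitShortFive (C : Type u) [Category.{v} C] [HasZeroMorphisms C] : Prop where
  isIso_middle : ∀ {K X Y K' X' Y' : C} {k : K ⟶ X} {f : X ⟶ Y} {k' : K' ⟶ X'} {f' : X' ⟶ Y'}
    (α : K ⟶ K') (β : X ⟶ X') (γ : Y ⟶ Y'),
    IsKernelOf k f → IsKernelOf k' f' → IsSplitEpi f → IsSplitEpi f' →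
    k ≫ β = α ≫ k' → f ≫ γ = β ≫ f' → IsIso α → IsIso γ → IsIso β

/-- A semi-abelian category: pointed (a zero object, with the zero morphisms it determines),
with binary coproducts, Barr exact (in particular finitely complete) and Bourn protomodular. -/
class IsSemiAbelian (C : Type u) [Category.{v} C] [HasZeroMorphisms C] : Prop extends
    IsBarrExact C, SplitShortFive C where
  hasZeroObject : HasZeroObject C
  hasBinaryCoproducts : HasBinaryCoproducts C

/-- A torsion theory in a category with zero morphisms: a pair of full replete subcategories
(given by isomorphism-closed properties of objects) such that every morphism from a torsion object
to a torsion-free object is zero, and every object `X` sits in a short exact sequence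
`0 ⟶ A ⟶ X ⟶ B ⟶ 0` with `A` torsion and `B` torsion-free. -/
structure TorsionTheory (C : Type u) [Category.{v} C] [HasZeroMorphisms C] where
  torsion : ObjectProperty C
  torsionFree : ObjectProperty C
  torsion_replete : torsion.IsClosedUnderIsomorphisms
  torsionFree_replete : torsionFree.IsClosedUnderIsomorphisms
  eq_zero : ∀ {A B : C} (f : A ⟶ B), torsion A → torsionFree B → f = 0
  exists_shortExact : ∀ X : C, ∃ (A B : C) (ε : A ⟶ X) (η : X ⟶ B),
    torsion A ∧ torsionFree B ∧ IsKernelOf ε η ∧ IsCokernelOf η ε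

namespace TorsionTheory

variable {C : Type u} [Category.{v} C] [HasZeroMorphisms C]

/-- `τ ≤ σ` when every torsion object of `τ` is a torsion object of `σ`. -/
instance : LE (TorsionTheory C) where
  le τ σ := τ.torsion ≤ σ.torsion

/-- The torsion subcategory is closed under subobjects. -/
def IsHereditary (τ : TorsionTheory C) : Prop :=
  ∀ {A B : C} (m : A ⟶ B), Mono m → τ.torsion B → τ.torsion A

/-- The torsion-free subcategory is closed under normal quotients. -/
def IsCohereditary (τ : TorsionTheory C) : Prop :=
  ∀ {A B : C} (q : A ⟶ B), Nonempty (NormalEpi q) → τ.torsionFree A → τ.torsionFree B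

/-- For `σ = (𝒮, 𝒢)` and `τ = (𝒯, ℱ)`, the class `𝒯 ∩ 𝒢` of trivial objects of the pair
`(𝒯, 𝒢)`. -/
abbrev trivialObjects (σ τ : TorsionTheory C) : ObjectProperty C :=
  τ.torsion ⊓ σ.torsionFree

end TorsionTheory

/-! ### Kernels, cokernels and protomodularity. -/

section Kernels

variable {C : Type u} [Category.{v} C] [HasZeroMorphisms C]

/-! The trivial objects are closed in `C` under finite limits and regular quotients, so exactness
and the split short five lemma are inherited. Torsion objects are always closed under quotients,
under subobjects by heredity, and under binary products by protomodularity
(`SplitShortFive.hom_ext`). Torsion-free objects are closed under all limits, and under regular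
quotients because `nonempty_normalEpi` makes these normal. Coproducts are torsion-free reflections,
for `σ`, of coproducts in `C`. -/

lemma IsKernelOf.mono {K X Y : C} {k : K ⟶ X} {f : X ⟶ Y} (h : IsKernelOf k f) : Mono k := by
  obtain ⟨w, ⟨hk⟩⟩ := h
  exact mono_of_isLimit_fork hk

lemma IsKernelOf.exists_lift {K X Y : C} {k : K ⟶ X} {f : X ⟶ Y} (h : IsKernelOf k f)
    {T : C} (t : T ⟶ X) (ht : t ≫ f = 0) : ∃ l : T ⟶ K, l ≫ k = t := by
  obtain ⟨w, ⟨hk⟩⟩ := h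
  exact ⟨_, (KernelFork.IsLimit.lift' hk t ht).2⟩

lemma IsKernelOf.mk {K X Y : C} {k : K ⟶ X} {f : X ⟶ Y} [Mono k] (w : k ≫ f = 0)
    (h : ∀ {T : C} (t : T ⟶ X), t ≫ f = 0 → ∃ l : T ⟶ K, l ≫ k = t) : IsKernelOf k f :=
  ⟨w, ⟨KernelFork.IsLimit.ofι' k w fun t ht => ⟨(h t ht).choose, (h t ht).choose_spec⟩⟩⟩

lemma IsCokernelOf.epi {X Y Q : C} {q : Y ⟶ Q} {f : X ⟶ Y} (h : IsCokernelOf q f) : Epi q := by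
  obtain ⟨w, ⟨hq⟩⟩ := h
  exact epi_of_isColimit_cofork hq

lemma IsCokernelOf.exists_desc {X Y Q : C} {q : Y ⟶ Q} {f : X ⟶ Y} (h : IsCokernelOf q f)
    {T : C} (t : Y ⟶ T) (ht : f ≫ t = 0) : ∃ l : Q ⟶ T, q ≫ l = t := by
  obtain ⟨w, ⟨hq⟩⟩ := h
  exact ⟨_, (CokernelCofork.IsColimit.desc' hq t ht).2⟩

/-- In a pointed protomodular category, the kernel and a section of a split epimorphism are
jointly epimorphic. -/
lemma SplitShortFive.hom_ext [SplitShortFive C] [HasEqualizers C] {K X Y Z : C} {k : K ⟶ X}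
    {f : X ⟶ Y} (hk : IsKernelOf k f) {s : Y ⟶ X} (hs : s ≫ f = 𝟙 Y) {g h : X ⟶ Z}
    (hkg : k ≫ g = k ≫ h) (hsg : s ≫ g = s ≫ h) : g = h := by
  have := hk.mono
  let k' : K ⟶ equalizer g h := equalizer.lift k hkg
  have hk' : k' ≫ equalizer.ι g h = k := equalizer.lift_ι _ _
  have : Mono k' := mono_of_mono_fac hk'
  have hker : IsKernelOf k' (equalizer.ι g h ≫ f) := by
    refine .mk (by rw [reassoc_of% hk', hk.choose]) fun t ht => ?_
    obtain ⟨l, hl⟩ := hk.exists_lift (t ≫ equalizer.ι g h) (by simpa using ht)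
    exact ⟨l, by rw [← cancel_mono (equalizer.ι g h), Category.assoc, hk', hl]⟩
  -- The equalizer contains both `k` and `s`, so the short five lemma makes it all of `X`.
  have : IsIso (equalizer.ι g h) :=
    SplitShortFive.isIso_middle (𝟙 K) (equalizer.ι g h) (𝟙 Y) hker hk
      (.mk' ⟨equalizer.lift s hsg, by simp [hs]⟩) (.mk' ⟨s, hs⟩) (by simp [hk']) (by simp)
      inferInstance inferInstance
  rw [← cancel_epi (equalizer.ι g h), equalizer.condition]

/-- In a pointed protomodular category with finite limits, regular epimorphisms are normal. -/
lemma nonempty_normalEpi [SplitShortFive C] [HasFiniteLimits C] {X Y : C}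
    (f : X ⟶ Y) [IsRegularEpi f] : Nonempty (NormalEpi f) := by
  have hR : IsKernelPair f (pullback.fst f f) (pullback.snd f f) := .of_hasPullback f
  refine ⟨{ W := kernel f, g := kernel.ι f, w := kernel.condition f, isColimit := ?_ }⟩
  -- The second projection of the kernel pair is split by the diagonal and has kernel `(kernel.ι f,
  -- 0)`. A map killing `kernel.ι f` thus coequalizes the kernel pair.
  have key : ∀ {Z : C} (g : X ⟶ Z), kernel.ι f ≫ g = 0 →
      pullback.fst f f ≫ g = pullback.snd f f ≫ g := by
    intro Z g hg
    have h0 : kernel.ι f ≫ f = 0 ≫ f := by simp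
    have : Mono (hR.lift (kernel.ι f) 0 h0) :=
      mono_of_mono_fac (h := kernel.ι f) (hR.lift_fst _ _ h0)
    have hk : IsKernelOf (hR.lift (kernel.ι f) 0 h0) (pullback.snd f f) := by
      refine .mk (by simp) fun t ht => ?_
      have ht' : (t ≫ pullback.fst f f) ≫ f = 0 := by
        rw [Category.assoc, hR.w, reassoc_of% ht, zero_comp]
      refine ⟨kernel.lift f _ ht', hR.hom_ext ?_ ?_⟩ <;> simp [ht]
    refine SplitShortFive.hom_ext hk (s := hR.lift (𝟙 X) (𝟙 X) rfl) (by simp) ?_ ?_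
    · simp only [IsKernelPair.lift_fst_assoc, IsKernelPair.lift_snd_assoc, hg, zero_comp]
    · simp
  exact CokernelCofork.IsColimit.ofπ _ _
    (fun g hg => Cofork.IsColimit.desc hR.toCoequalizer' g (key g hg))
    (fun g hg => Cofork.IsColimit.π_desc' hR.toCoequalizer' g (key g hg))
    (fun g hg m hm => Cofork.IsColimit.hom_ext hR.toCoequalizer'
      (hm.trans (Cofork.IsColimit.π_desc' hR.toCoequalizer' g (key g hg)).symm))

end Kernels

/-! ### Exactness and protomodularity of full subcategories. -/

namespace CategoryTheory.ObjectProperty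

variable {C : Type u} [Category.{v} C] (P : ObjectProperty C)

/-- A finite limit embeds in the product of the objects of its diagram. -/
lemma isClosedUnderLimitsOfShape_of_isClosedUnderSubobjects [HasFiniteProducts C]
    [P.IsClosedUnderSubobjects] [P.IsClosedUnderFiniteProducts] (J : Type) [SmallCategory J]
    [FinCategory J] : P.IsClosedUnderLimitsOfShape J where
  limitsOfShape_le := by
    rintro X ⟨p⟩
    have : Mono (Pi.lift fun j => p.π.app j) := ⟨fun f g h => p.isLimit.hom_ext fun j => by
      simpa using h =≫ Pi.π _ j⟩
    exact P.prop_of_mono (Pi.lift fun j => p.π.app j) (P.prop_product p.prop_diag_obj)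

/-- A full subcategory of a Barr exact category which is closed under finite limits and regular
quotients is Barr exact. -/
lemma isBarrExact_fullSubcategory [IsBarrExact C]
    (hlim : ∀ (J : Type) [SmallCategory J] [FinCategory J], P.IsClosedUnderLimitsOfShape J)
    (hquot : ∀ {X Y : C} (f : X ⟶ Y), IsRegularEpi f → P X → P Y) :
    IsBarrExact P.FullSubcategory := by
  have : HasFiniteLimits P.FullSubcategory := ⟨fun J _ _ => inferInstance⟩
  have : PreservesFiniteLimits P.ι := ⟨fun J _ _ => inferInstance⟩
  have hcoeq : ∀ {X Y Z : P.FullSubcategory} {f : X ⟶ Y} {g₁ g₂ : Z ⟶ X}, IsKernelPair f g₁ g₂ →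
      ∃ (Q : P.FullSubcategory) (q : X ⟶ Q) (w : g₁ ≫ q = g₂ ≫ q),
        IsRegularEpi q.hom ∧ Nonempty (IsColimit (Cofork.ofπ q w)) := by
    intro X Y Z f g₁ g₂ h
    have : HasCoequalizer g₁.hom g₂.hom := Regular.hasCoequalizer_of_isKernelPair (h.map P.ι)
    let q : X ⟶ ⟨_, hquot (coequalizer.π g₁.hom g₂.hom) inferInstance X.property⟩ :=
      homMk (coequalizer.π g₁.hom g₂.hom)
    refine ⟨_, q, hom_ext _ (coequalizer.condition _ _), inferInstanceAs
      (IsRegularEpi (coequalizer.π g₁.hom g₂.hom)), ⟨Cofork.IsColimit.mk _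
      (fun s => homMk (coequalizer.desc s.π.hom congr(($s.condition).hom)))
      (fun s => hom_ext _ (coequalizer.π_desc _ _)) (fun s m hm => ?_)⟩⟩
    exact hom_ext _ (coequalizer.hom_ext
      ((congr(($hm).hom)).trans (coequalizer.π_desc _ _).symm))
  -- Both sides say that `f` is the coequalizer of its kernel pair, which is computed alike in `P`
  -- and in `C`.
  have hreg : ∀ {X Y : P.FullSubcategory} (f : X ⟶ Y), IsRegularEpi f ↔ IsRegularEpi f.hom := by
    intro X Y f
    have hk := IsKernelPair.of_hasPullback f
    constructor
    · intro hf
      obtain ⟨Q, q, w, hq, ⟨hq'⟩⟩ := hcoeq hk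
      let e := IsColimit.coconePointUniqueUpToIso hq' hk.toCoequalizer'
      have he : q ≫ e.hom = f := IsColimit.comp_coconePointUniqueUpToIso_hom hq' _ .one
      exact (MorphismProperty.arrow_mk_iso_iff (.regularEpi C) (f := q.hom) (g := f.hom)
        (Arrow.isoMk (Iso.refl _) (P.ι.mapIso e) (by simp [← he]))).1 hq
    · intro hf
      have hc := IsKernelPair.toCoequalizer' (f := f.hom) (hk.map P.ι)
      exact ⟨⟨_, _, _, hk.w, Cofork.IsColimit.mk _
        (fun s => homMk (Cofork.IsColimit.desc hc s.π.hom congr(($s.condition).hom)))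
        (fun s => hom_ext _ (Cofork.IsColimit.π_desc' hc _ _))
        (fun s m hm => hom_ext _ (Cofork.IsColimit.hom_ext hc
          (congr(($hm).hom).trans (Cofork.IsColimit.π_desc' hc _ _).symm)))⟩⟩
  exact
  { hasCoequalizer_of_isKernelPair := fun h => by
      obtain ⟨Q, q, w, -, ⟨hq⟩⟩ := hcoeq h
      exact ⟨⟨_, hq⟩⟩
    regularEpiIsStableUnderBaseChange := ⟨fun {X Y Y' S f g f' g'} sq hg => by
      rw [MorphismProperty.regularEpi_iff, hreg] at hg ⊢
      exact Regular.regularEpiIsStableUnderBaseChange.of_isPullback (sq.map P.ι) hg⟩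
    exists_isKernelPair := fun {R X} p₁ p₂ ⟨⟨e⟩⟩ => by
      -- Since `X ⨯ X` lies in `P`, the pair amounts to a single mono, which `P.ι` preserves.
      have : JointlyMono₂ (P.ι.map p₁) (P.ι.map p₂) := by
        have hXX : P (X.obj ⨯ X.obj) :=
          have := hlim (Discrete WalkingPair)
          P.prop_prod _ _ X.property X.property
        let m : R ⟶ ⟨_, hXX⟩ := homMk (prod.lift p₁.hom p₂.hom)
        have hm₁ : m.hom ≫ prod.fst = p₁.hom := prod.lift_fst _ _
        have hm₂ : m.hom ≫ prod.snd = p₂.hom := prod.lift_snd _ _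
        have : Mono m := ⟨fun f g h => by
          replace h : f.hom ≫ m.hom = g.hom ≫ m.hom := congr(($h).hom)
          refine e.right_cancellation f g (hom_ext _ ?_) (hom_ext _ ?_)
          · simpa [hm₁] using h =≫ prod.fst
          · simpa [hm₂] using h =≫ prod.snd⟩
        have hm : Mono (P.ι.map m) := inferInstance
        refine ⟨fun Y f g h₁ h₂ => hm.right_cancellation f g (Limits.prod.hom_ext ?_ ?_)⟩
        · simpa [hm₁] using h₁
        · simpa [hm₂] using h₂
      obtain ⟨Y, f, hf⟩ := IsBarrExact.exists_isKernelPair (P.ι.map p₁) (P.ι.map p₂)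
        ⟨⟨{ __ := e.toReflexiveRelation.map P.ι
            __ := e.toSymmetricRelation.map P.ι
            __ := e.toTransitiveRelation.map P.ι }⟩⟩
      -- `Y` may lie outside `P`; the regular image of `f` is a quotient of `X`, hence in `P`, and
      -- has the same kernel pair.
      let F := Regular.strongEpiMonoFactorisation f
      have hF : IsRegularEpi F.e := inferInstance
      have hFm : Mono F.m := F.m_mono
      refine ⟨⟨F.I, hquot F.e hF X.property⟩, homMk F.e, .of_map P.ι
        (hom_ext _ ?_) ?_⟩
      · have := hf.w
        rw [← F.fac, ← Category.assoc, ← Category.assoc, cancel_mono] at this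
        exact this
      · rw [← F.fac] at hf
        exact IsKernelPair.cancel_right_of_mono hf }

lemma splitShortFive_fullSubcategory [HasZeroMorphisms C] [SplitShortFive C]
    [HasFiniteLimits P.FullSubcategory] [PreservesFiniteLimits P.ι] :
    SplitShortFive P.FullSubcategory where
  isIso_middle {K X Y K' X' Y' k f k' f'} α β γ hk hk' hf hf' h₁ h₂ hα hγ := by
    have hker : ∀ {A B D : P.FullSubcategory} {i : A ⟶ B} {p : B ⟶ D}, IsKernelOf i p →
        IsKernelOf i.hom p.hom := fun ⟨w, ⟨hi⟩⟩ =>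
      ⟨congr(($w).hom), ⟨KernelFork.mapIsLimit _ hi P.ι⟩⟩
    rw [← isIso_hom_iff]
    exact SplitShortFive.isIso_middle α.hom β.hom γ.hom (hker hk) (hker hk')
      (inferInstanceAs (IsSplitEpi (P.ι.map f))) (inferInstanceAs (IsSplitEpi (P.ι.map f')))
      congr(($h₁).hom) congr(($h₂).hom) inferInstance inferInstance

end CategoryTheory.ObjectProperty

/-! ### Closure properties of torsion theories. -/

namespace TorsionTheory

variable {C : Type u} [Category.{v} C] [HasZeroMorphisms C] (τ : TorsionTheory C)

/-- If all these maps vanish then so does `η`, and its kernel `ε` is invertible. -/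
lemma torsion_iff (X : C) :
    τ.torsion X ↔ ∀ {F : C} (f : X ⟶ F), τ.torsionFree F → f = 0 := by
  refine ⟨fun hX F f hF => τ.eq_zero f hX hF, fun h => ?_⟩
  obtain ⟨A, B, ε, η, hA, hB, hε, -⟩ := τ.exists_shortExact X
  have := hε.mono
  obtain ⟨s, hs⟩ := hε.exists_lift (𝟙 X) (by rw [h η hB, comp_zero])
  have := τ.torsion_replete
  exact τ.torsion.prop_of_iso ⟨ε, s, by rw [← cancel_mono ε, Category.assoc, hs]; simp, hs⟩ hA

lemma torsionFree_iff (X : C) :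
    τ.torsionFree X ↔ ∀ {T : C} (f : T ⟶ X), τ.torsion T → f = 0 := by
  refine ⟨fun hX T f hT => τ.eq_zero f hT hX, fun h => ?_⟩
  obtain ⟨A, B, ε, η, hA, hB, -, hη⟩ := τ.exists_shortExact X
  have := hη.epi
  obtain ⟨s, hs⟩ := hη.exists_desc (𝟙 X) (by rw [h ε hA, zero_comp])
  have := τ.torsionFree_replete
  exact τ.torsionFree.prop_of_iso
    ⟨s, η, by rw [← cancel_epi η, reassoc_of% hs]; simp, hs⟩ hB

instance : τ.torsion.IsClosedUnderQuotients where
  prop_of_epi {X Y} p _ hX := (τ.torsion_iff Y).2 fun f hF => by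
    rw [← cancel_epi p, τ.eq_zero (p ≫ f) hX hF, comp_zero]

instance : τ.torsionFree.IsClosedUnderSubobjects where
  prop_of_mono {X Y} i _ hY := (τ.torsionFree_iff X).2 fun f hT => by
    rw [← cancel_mono i, τ.eq_zero (f ≫ i) hT hY, zero_comp]

lemma torsion_of_isZero {X : C} (hX : IsZero X) : τ.torsion X :=
  (τ.torsion_iff X).2 fun _ _ => hX.eq_of_src _ _

lemma torsionFree_of_isZero {X : C} (hX : IsZero X) : τ.torsionFree X :=
  (τ.torsionFree_iff X).2 fun _ _ => hX.eq_of_tgt _ _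

lemma torsion_coprod {X Y : C} [HasBinaryCoproduct X Y] (hX : τ.torsion X) (hY : τ.torsion Y) :
    τ.torsion (X ⨿ Y) :=
  (τ.torsion_iff _).2 fun f hF => coprod.hom_ext
    (by rw [τ.eq_zero (coprod.inl ≫ f) hX hF, comp_zero])
    (by rw [τ.eq_zero (coprod.inr ≫ f) hY hF, comp_zero])

instance (J : Type*) [Category J] : τ.torsionFree.IsClosedUnderLimitsOfShape J where
  limitsOfShape_le := by
    rintro X ⟨p⟩
    exact (τ.torsionFree_iff X).2 fun f hT => p.isLimit.hom_ext fun j => by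
      rw [τ.eq_zero (f ≫ p.π.app j) hT (p.prop_diag_obj j), zero_comp]

/-- The two axis inclusions into a product are jointly epic, and maps from torsion factors to a
torsion-free object vanish. -/
instance [SplitShortFive C] [HasEqualizers C] :
    τ.torsion.IsClosedUnderBinaryProducts where
  limitsOfShape_le := by
    rintro X ⟨p⟩
    let c : BinaryFan (p.diag.obj ⟨.left⟩) (p.diag.obj ⟨.right⟩) :=
      BinaryFan.mk (p.π.app ⟨.left⟩) (p.π.app ⟨.right⟩)
    have hext : ∀ {T : C} (a b : T ⟶ X), a ≫ p.π.app ⟨.left⟩ = b ≫ p.π.app ⟨.left⟩ →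
        a ≫ p.π.app ⟨.right⟩ = b ≫ p.π.app ⟨.right⟩ → a = b := fun a b h₁ h₂ =>
      p.isLimit.hom_ext (by rintro ⟨_ | _⟩ <;> assumption)
    have hlift : ∀ {T : C} (a : T ⟶ p.diag.obj ⟨.left⟩) (b : T ⟶ p.diag.obj ⟨.right⟩),
        ∃ l : T ⟶ X, l ≫ p.π.app ⟨.left⟩ = a ∧ l ≫ p.π.app ⟨.right⟩ = b := by
      intro T a b
      let c : Cone p.diag := ⟨T, Discrete.natTrans fun ⟨j⟩ => WalkingPair.casesOn j a b⟩
      exact ⟨p.isLimit.lift c, p.isLimit.fac c ⟨.left⟩, p.isLimit.fac c ⟨.right⟩⟩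
    obtain ⟨i, hi₁, hi₂⟩ := hlift (𝟙 _) 0
    obtain ⟨s, hs₁, hs₂⟩ := hlift 0 (𝟙 _)
    have : Mono i := mono_of_mono_fac (h := 𝟙 _) hi₁
    have hk : IsKernelOf i (p.π.app ⟨.right⟩) :=
      .mk hi₂ fun t ht => ⟨t ≫ p.π.app ⟨.left⟩, hext _ _ (by simp [hi₁]) (by simp [hi₂, ht])⟩
    refine (τ.torsion_iff X).2 fun f hF => SplitShortFive.hom_ext hk hs₂ ?_ ?_
    · rw [τ.eq_zero (i ≫ f) (p.prop_diag_obj _) hF, comp_zero]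
    · rw [τ.eq_zero (s ≫ f) (p.prop_diag_obj _) hF, comp_zero]

/-- The reflection of the coproduct in `C` to the torsion-free part of `σ` is the coproduct of
trivial objects. -/
lemma hasBinaryCoproducts_trivialObjects [HasBinaryCoproducts C] (σ τ : TorsionTheory C) :
    HasBinaryCoproducts (trivialObjects σ τ).FullSubcategory := by
  refine @hasBinaryCoproducts_of_hasColimit_pair _ _ fun {X Y} => ?_
  obtain ⟨A, B, ε, η, hA, hB, -, hη⟩ := σ.exists_shortExact (X.obj ⨿ Y.obj)
  have := hη.epi
  let S : (trivialObjects σ τ).FullSubcategory :=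
    ⟨B, τ.torsion.prop_of_epi η (τ.torsion_coprod X.property.1 Y.property.1), hB⟩
  let inl : X ⟶ S := ObjectProperty.homMk (coprod.inl ≫ η)
  let inr : Y ⟶ S := ObjectProperty.homMk (coprod.inr ≫ η)
  -- The `σ`-torsion part `A` has only zero maps to `T`, so maps out of the coproduct factor through
  -- `η`.
  have hdesc : ∀ {T : (trivialObjects σ τ).FullSubcategory} (f : X ⟶ T) (g : Y ⟶ T),
      ∃ l : B ⟶ T.obj, η ≫ l = coprod.desc f.hom g.hom := fun {T} f g =>
    hη.exists_desc _ (σ.eq_zero _ hA T.property.2)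
  choose l hl using @hdesc
  have hinl {T : (trivialObjects σ τ).FullSubcategory} (f : X ⟶ T) (g : Y ⟶ T) :
      (coprod.inl ≫ η) ≫ l f g = f.hom := by rw [Category.assoc, hl, coprod.inl_desc]
  have hinr {T : (trivialObjects σ τ).FullSubcategory} (f : X ⟶ T) (g : Y ⟶ T) :
      (coprod.inr ≫ η) ≫ l f g = g.hom := by rw [Category.assoc, hl, coprod.inr_desc]
  exact ⟨⟨_, BinaryCofan.isColimitMk (inl := inl) (inr := inr)
    (fun s => ObjectProperty.homMk (l s.inl s.inr))
    (fun s => ObjectProperty.hom_ext _ (hinl s.inl s.inr))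
    (fun s => ObjectProperty.hom_ext _ (hinr s.inl s.inr))
    (fun s m h₁ h₂ => ObjectProperty.hom_ext _ (by
      rw [← cancel_epi η]
      refine coprod.hom_ext ?_ ?_
      · rw [← Category.assoc, ← Category.assoc]
        exact congr(($h₁).hom).trans (hinl s.inl s.inr).symm
      · rw [← Category.assoc, ← Category.assoc]
        exact congr(($h₂).hom).trans (hinr s.inl s.inr).symm))⟩⟩

end TorsionTheory

theorem mainTheorem7 {C : Type u} [Category.{v} C] [HasZeroMorphisms C] [IsSemiAbelian C]
    (τ σ : TorsionTheory C) (hle : σ ≤ τ) (hτ : τ.IsHereditary) (hσ : σ.IsCohereditary) :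
    IsSemiAbelian (TorsionTheory.trivialObjects σ τ).FullSubcategory := by
  have := IsSemiAbelian.hasZeroObject (C := C)
  have := IsSemiAbelian.hasBinaryCoproducts (C := C)
  have : τ.torsion.IsClosedUnderSubobjects := ⟨fun m _ => hτ m inferInstance⟩
  have : τ.torsion.ContainsZero := ⟨_, isZero_zero C, τ.torsion_of_isZero (isZero_zero C)⟩
  have : σ.torsionFree.ContainsZero := ⟨_, isZero_zero C, σ.torsionFree_of_isZero (isZero_zero C)⟩
  have : τ.torsion.IsClosedUnderFiniteProducts := .mk'
  have hlim (J : Type) [SmallCategory J] [FinCategory J] :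
      (TorsionTheory.trivialObjects σ τ).IsClosedUnderLimitsOfShape J := by
    have := τ.torsion.isClosedUnderLimitsOfShape_of_isClosedUnderSubobjects J
    exact ⟨fun X ⟨p⟩ => ⟨τ.torsion.prop_of_isLimit p.isLimit fun j => (p.prop_diag_obj j).1,
      σ.torsionFree.prop_of_isLimit p.isLimit fun j => (p.prop_diag_obj j).2⟩⟩
  have : IsBarrExact (TorsionTheory.trivialObjects σ τ).FullSubcategory :=
    ObjectProperty.isBarrExact_fullSubcategory _ hlim fun f _ hX =>
      ⟨τ.torsion.prop_of_epi f hX.1, hσ f (nonempty_normalEpi f) hX.2⟩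
  have : PreservesFiniteLimits (TorsionTheory.trivialObjects σ τ).ι :=
    ⟨fun J _ _ => inferInstance⟩
  have := ObjectProperty.splitShortFive_fullSubcategory (TorsionTheory.trivialObjects σ τ)
  exact
  { hasZeroObject := inferInstance
    hasBinaryCoproducts := TorsionTheory.hasBinaryCoproducts_trivialObjects σ τ }
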